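/- For a real number $x$ let $\|x\|=\min_{n\in\mathbb Z}|x-n|$, and for irrational $\alpha$ and an integer $M\ge 1$ let $$S_M(\alpha)=\sum_{m=1}^M\frac1{\|m\alpha\|}.$$ Let $\varphi:(0,\infty)\to(0,\infty)$ be a non-decreasing function. Then, for almost every $\alpha\in[0,1)$ with respect to Lebesgue measure, $$\limsup_{M\to\infty}\frac{S_M(\alpha)}{M\,\log M\;\varphi(\log M)}=\begin{cases}0&\text{if }\displaystyle\sum_{k=1}^\infty\frac1{k\,\varphi(k)}<\infty,\\[2ex] \infty&\text{if }\displaystyle\sum_{k=1}^\infty\frac1{k\,\varphi(k)}=\infty.\end{cases}$$ -/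

import Mathlib

/-- The distance `‖x‖ = min_{n ∈ ℤ} |x - n|` from a real number `x` to the nearest integer. -/
noncomputable def distNearestInt (x : ℝ) : ℝ := |x - round x|

/-- `distNearestInt x` is indeed the minimum of `|x - n|` over the integers `n`. -/
theorem distNearestInt_isLeast (x : ℝ) :
    IsLeast (Set.range fun n : ℤ => |x - (n : ℝ)|) (distNearestInt x) := by
  refine ⟨⟨round x, rfl⟩, ?_⟩
  rintro _ ⟨n, rfl⟩
  exact round_le x n

/-- The sum `S_M(α) = ∑_{m=1}^M 1 / ‖m α‖` (meaningful for irrational `α`). -/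
noncomputable def recipDistSum (M : ℕ) (α : ℝ) : ℝ :=
  ∑ m ∈ Finset.Icc 1 M, 1 / distNearestInt ((m : ℝ) * α)

open MeasureTheory Filter Topology

/-! ### The distance to the nearest integer -/

/-! Up to a term of order `M log M`, the sum is governed by its largest term. Let `q` minimise
`‖mα‖` over `1 ≤ m ≤ M`. Dirichlet's theorem and minimality give `‖rα‖ ≥ 1/(2q)` for `1 ≤ r ≤ q/2`,
so over a block of about `q/2` consecutive `m` the points `mα` are `1/(2q)`-separated mod 1. A block
therefore contributes at most a constant times `1/‖qα‖ + q(1 + log q)`, and there are at most `3M/q`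
blocks. Hence `S_M(α) ≪ M (1/(q‖qα‖) + 1 + log M)` (`recipDistSum_le_of_minimal`), without continued
fractions.

Write `W(q) = log q · φ(log q)`. By Cauchy condensation, `∑ 1/(q W(q))` and `∑ 1/(k φ(k))` converge
or diverge together.

If they converge, Borel–Cantelli gives `1/(q‖qα‖) ≤ C + ε W(q)` for almost every `α`
(`ae_exists_one_div_le`). Also `φ → ∞`, so the `log M` term is negligible too.

If they diverge, Khinchin's theorem gives `‖qα‖ < 1/(K q W(q))` for infinitely many `q`, and the
single term `m = q` already makes `S_q(α) > K q W(q)`. Khinchin's theorem is obtained from reduced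
fractions with denominators in `(4^n, 4^(n+1)]`: these are numerous and well separated, so balls
around them are quasi-independent across blocks (`sum_overlap_le`). The Chung–Erdős inequality then
gives a limsup set of positive measure (`volume_frequently_ne_zero`), and Gallagher's zero-one law
upgrades this to full measure. -/

theorem distNearestInt_le (x : ℝ) (n : ℤ) : distNearestInt x ≤ |x - n| :=
  round_le x n

theorem distNearestInt_nonneg (x : ℝ) : 0 ≤ distNearestInt x :=
  abs_nonneg _

theorem distNearestInt_le_half (x : ℝ) : distNearestInt x ≤ 1 / 2 :=
  abs_sub_round x

theorem distNearestInt_pos {α : ℝ} (hα : Irrational α) {m : ℕ} (hm : 1 ≤ m) :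
    0 < distNearestInt (m * α) := by
  refine abs_pos.mpr (sub_ne_zero.mpr ?_)
  exact (hα.natCast_mul (by lia)).ne_int _

theorem distNearestInt_sub_le (a b α : ℝ) :
    distNearestInt ((a - b) * α) ≤
      |(a * α - round (a * α)) - (b * α - round (b * α))| := by
  refine (distNearestInt_le _ (round (a * α) - round (b * α))).trans_eq ?_
  push_cast
  ring_nf

/-! ### The deterministic upper bound -/

/-- If `q` minimises `‖m α‖` over `1 ≤ m ≤ M`, then `‖r α‖ ≥ 1 / (2 q)` for `r ≤ q / 2`. -/
theorem le_distNearestInt_of_minimal {α : ℝ} (hα : Irrational α) {M q r : ℕ}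
    (hq : 1 ≤ q) (hqM : q ≤ M)
    (hmin : ∀ m, 1 ≤ m → m ≤ M → distNearestInt (q * α) ≤ distNearestInt (m * α))
    (hr : 1 ≤ r) (hrq : 2 * r ≤ q) :
    1 / (2 * q : ℝ) ≤ distNearestInt (r * α) := by
  obtain ⟨m, hm0, hmM, hm⟩ := Real.exists_nat_abs_mul_sub_round_le α (n := M) (by lia)
  have hθ : distNearestInt (q * α) ≤ 1 / ((M : ℝ) + 1) := (hmin m hm0 hmM).trans hm
  have hqR : (1 : ℝ) ≤ q := by exact_mod_cast hq
  have hrR : (1 : ℝ) ≤ r := by exact_mod_cast hr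
  have hrqR : 2 * (r : ℝ) ≤ q := by exact_mod_cast hrq
  have hqMR : (q : ℝ) ≤ M := by exact_mod_cast hqM
  have hθq : distNearestInt (q * α) ≤ 1 / q :=
    hθ.trans (one_div_le_one_div_of_le (by linarith) (by linarith))
  have hθpos := distNearestInt_pos hα hq
  have key : (q : ℝ) * ((r : ℝ) * α - round ((r : ℝ) * α)) =
      (((r : ℤ) * round ((q : ℝ) * α) - round ((r : ℝ) * α) * q : ℤ) : ℝ)
        + r * ((q : ℝ) * α - round ((q : ℝ) * α)) := by
    push_cast; ring
  have habs : |(r : ℝ) * ((q : ℝ) * α - round ((q : ℝ) * α))| = r * distNearestInt (q * α) := by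
    rw [abs_mul, Nat.abs_cast]; rfl
  have hqd : (q : ℝ) * distNearestInt (r * α)
      = |(q : ℝ) * ((r : ℝ) * α - round ((r : ℝ) * α))| := by
    rw [abs_mul, Nat.abs_cast]; rfl
  have hrθ : (r : ℝ) * distNearestInt (q * α) ≤ 1 / 2 := by
    calc (r : ℝ) * distNearestInt (q * α) ≤ (q / 2) * (1 / q) := by gcongr; linarith
      _ = 1 / 2 := by field_simp
  rw [div_le_iff₀ (by positivity)]
  -- If the integer part of `key` vanishes, then `q‖rα‖ = r‖qα‖ ≤ r‖rα‖`, impossible for `r < q`.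
  -- Otherwise that integer has size at least 1 and the perturbation `r‖qα‖` is at most 1/2.
  by_cases h0 : (r : ℤ) * round ((q : ℝ) * α) - round ((r : ℝ) * α) * q = 0
  · rw [key, h0, Int.cast_zero, zero_add, habs] at hqd
    have := hmin r hr (by lia)
    nlinarith
  · have h1 : (1 : ℝ) ≤ |(((r : ℤ) * round ((q : ℝ) * α) - round ((r : ℝ) * α) * q : ℤ) : ℝ)| := by
      exact_mod_cast Int.one_le_abs h0
    rw [key] at hqd
    have h2 := abs_sub_abs_le_abs_add
      ((((r : ℤ) * round ((q : ℝ) * α) - round ((r : ℝ) * α) * q : ℤ) : ℝ))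
      (r * ((q : ℝ) * α - round ((q : ℝ) * α)))
    rw [habs, ← hqd] at h2
    linarith

/-- The sum of the reciprocals of a finite set of `s`-separated positive reals. -/
theorem sum_one_div_le_of_separated {ι : Type*} (B : Finset ι) (y : ι → ℝ) {s δ : ℝ} (n : ℕ)
    (hs : 0 < s) (hδ : 0 < δ) (hy : ∀ i ∈ B, δ ≤ y i) (hyn : ∀ i ∈ B, y i < (n + 1) * s)
    (hsep : ∀ i ∈ B, ∀ j ∈ B, i ≠ j → s ≤ |y i - y j|) :
    ∑ i ∈ B, 1 / y i ≤ 1 / δ + 1 / s * (harmonic n : ℝ) := by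
  classical
  set k : ι → ℕ := fun i => ⌊y i / s⌋₊ with hk
  have hpos : ∀ i ∈ B, 0 < y i := fun i hi => hδ.trans_le (hy i hi)
  have hinj : Set.InjOn k B := by
    intro i hi j hj hij
    by_contra hne
    have h1 := hsep i hi j hj hne
    have hlt : |y i / s - y j / s| < 1 := by
      have a1 := Nat.floor_le (div_nonneg (hpos i hi).le hs.le)
      have a2 := Nat.lt_floor_add_one (y i / s)
      have b1 := Nat.floor_le (div_nonneg (hpos j hj).le hs.le)
      have b2 := Nat.lt_floor_add_one (y j / s)
      have : (⌊y i / s⌋₊ : ℝ) = ⌊y j / s⌋₊ := by exact_mod_cast hij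
      rw [abs_lt]; constructor <;> linarith
    rw [← sub_div, abs_div, abs_of_pos hs, div_lt_one hs] at hlt
    linarith
  -- The cells `[js, (j+1)s)` hold at most one point each. The point in cell 0 is bounded through
  -- `δ`, the one in cell `j ≥ 1` through `y ≥ js`.
  let w : ℕ → ℝ := fun j => if j = 0 then 1 / δ else 1 / s * (j : ℝ)⁻¹
  have hw : ∀ j, 0 ≤ w j := fun j => by
    simp only [w]; split_ifs <;> positivity
  calc ∑ i ∈ B, 1 / y i ≤ ∑ i ∈ B, w (k i) := by
        refine Finset.sum_le_sum fun i hi => ?_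
        simp only [w]
        split_ifs with h
        · exact one_div_le_one_div_of_le hδ (hy i hi)
        · have hkpos : (0 : ℝ) < k i := by exact_mod_cast Nat.pos_of_ne_zero h
          have := Nat.floor_le (div_nonneg (hpos i hi).le hs.le)
          rw [le_div_iff₀ hs] at this
          rw [← one_div, one_div_mul_one_div]
          exact one_div_le_one_div_of_le (by positivity) (by rw [mul_comm]; exact this)
    _ = ∑ j ∈ B.image k, w j := (Finset.sum_image hinj).symm
    _ ≤ ∑ j ∈ Finset.range (n + 1), w j := by
        refine Finset.sum_le_sum_of_subset_of_nonneg ?_ fun j _ _ => hw j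
        intro j hj
        obtain ⟨i, hi, rfl⟩ := Finset.mem_image.mp hj
        rw [Finset.mem_range, hk, Nat.floor_lt (div_nonneg (hpos i hi).le hs.le), div_lt_iff₀ hs]
        exact_mod_cast hyn i hi
    _ = 1 / δ + 1 / s * (harmonic n : ℝ) := by
        rw [Finset.sum_range_succ', add_comm]
        simp [w, harmonic, Finset.mul_sum]

/-- Differences of indices within the block are at most `q/2`, so the signed distances to the
nearest integer are `1/(2q)`-separated. Taking absolute values preserves separation only among
points of equal sign, hence the two halves and the factor 2. -/
theorem sum_block_le {α : ℝ} (hα : Irrational α) {M q : ℕ} (hq : 1 ≤ q) (hqM : q ≤ M)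
    (hmin : ∀ m, 1 ≤ m → m ≤ M → distNearestInt (q * α) ≤ distNearestInt (m * α))
    (B : Finset ℕ) (hB : ∀ m ∈ B, 1 ≤ m ∧ m ≤ M)
    (hdiam : ∀ m ∈ B, ∀ m' ∈ B, m < m' → 2 * (m' - m) ≤ q) :
    ∑ m ∈ B, 1 / distNearestInt (m * α) ≤
      2 * (1 / distNearestInt (q * α) + 2 * q * (1 + Real.log q)) := by
  have hqR : (1 : ℝ) ≤ q := by exact_mod_cast hq
  have hsep : ∀ m ∈ B, ∀ m' ∈ B, m ≠ m' → 1 / (2 * q : ℝ) ≤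
      |((m : ℝ) * α - round ((m : ℝ) * α)) - ((m' : ℝ) * α - round ((m' : ℝ) * α))| := by
    have main : ∀ m ∈ B, ∀ m' ∈ B, m < m' → 1 / (2 * q : ℝ) ≤
      |((m' : ℝ) * α - round ((m' : ℝ) * α)) - ((m : ℝ) * α - round ((m : ℝ) * α))| := by
      intro m hm m' hm' hlt
      have h1 := le_distNearestInt_of_minimal hα hq hqM hmin (r := m' - m) (by lia)
        (hdiam m hm m' hm' hlt)
      rw [Nat.cast_sub hlt.le] at h1
      exact h1.trans (distNearestInt_sub_le _ _ _)
    intro m hm m' hm' hne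
    rcases hne.lt_or_gt with h | h
    · rw [abs_sub_comm]; exact main m hm m' hm' h
    · exact main m' hm' m hm h
  have half : ∀ B' ⊆ B, (∀ m ∈ B', ∀ m' ∈ B',
      |distNearestInt (m * α) - distNearestInt (m' * α)| =
      |((m : ℝ) * α - round ((m : ℝ) * α)) - ((m' : ℝ) * α - round ((m' : ℝ) * α))|) →
      ∑ m ∈ B', 1 / distNearestInt (m * α) ≤
        1 / distNearestInt (q * α) + 2 * q * (1 + Real.log q) := by
    intro B' hB' habs
    refine (sum_one_div_le_of_separated B' (fun m : ℕ => distNearestInt (m * α))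
      (s := 1 / (2 * q : ℝ)) (δ := distNearestInt (q * α)) q (by positivity)
      (distNearestInt_pos hα hq) (fun m hm => ?_) (fun m hm => ?_) ?_).trans ?_
    · exact hmin m (hB m (hB' hm)).1 (hB m (hB' hm)).2
    · refine (distNearestInt_le_half _).trans_lt ?_
      rw [mul_one_div, div_lt_div_iff₀ (by norm_num) (by positivity)]
      linarith
    · intro m hm m' hm' hne
      rw [habs m hm m' hm']
      exact hsep m (hB' hm) m' (hB' hm') hne
    · rw [one_div_one_div]
      gcongr
      exact harmonic_le_one_add_log q
  rw [← Finset.sum_filter_add_sum_filter_not B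
    (fun m : ℕ => 0 ≤ (m : ℝ) * α - round ((m : ℝ) * α)), two_mul]
  refine add_le_add (half _ (Finset.filter_subset _ _) ?_) (half _ (Finset.filter_subset _ _) ?_)
  · intro m hm m' hm'
    rw [Finset.mem_filter] at hm hm'
    simp only [distNearestInt, abs_of_nonneg hm.2, abs_of_nonneg hm'.2]
  · intro m hm m' hm'
    rw [Finset.mem_filter, not_le] at hm hm'
    simp only [distNearestInt, abs_of_neg hm.2, abs_of_neg hm'.2]
    rw [abs_sub_comm]
    ring_nf

theorem recipDistSum_le_of_minimal {α : ℝ} (hα : Irrational α) {M q : ℕ} (hq : 1 ≤ q)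
    (hqM : q ≤ M)
    (hmin : ∀ m, 1 ≤ m → m ≤ M → distNearestInt (q * α) ≤ distNearestInt (m * α)) :
    recipDistSum M α ≤
      M * (6 * (1 / (q * distNearestInt (q * α))) + 12 * (1 + Real.log M)) := by
  have hqR : (1 : ℝ) ≤ q := by exact_mod_cast hq
  have hqMR : (q : ℝ) ≤ M := by exact_mod_cast hqM
  have hd := distNearestInt_pos hα hq
  -- The block length is `⌈q/2⌉`: two indices in one block differ by at most `h - 1 ≤ q/2`, while `h
  -- ≥ q/2` keeps the number of blocks below `3M/q`.
  set h := (q + 1) / 2 with hh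
  have hhpos : 0 < h := by lia
  have hblocks : ∀ i ∈ Finset.range (M / h + 1),
      ∑ m ∈ (Finset.Icc 1 M).filter (fun m => m / h = i), 1 / distNearestInt (m * α) ≤
      2 * (1 / distNearestInt (q * α) + 2 * q * (1 + Real.log q)) := by
    intro i _
    refine sum_block_le hα hq hqM hmin _ (fun m hm => ?_) ?_
    · exact Finset.mem_Icc.mp (Finset.mem_filter.mp hm).1
    · intro m hm m' hm' hlt
      have h1 := (Finset.mem_filter.mp hm).2
      have h2 := (Finset.mem_filter.mp hm').2
      have e1 := Nat.div_add_mod m h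
      have e2 := Nat.div_add_mod m' h
      have l2 := Nat.mod_lt m' hhpos
      rw [h1] at e1
      rw [h2] at e2
      lia
  have hcard : ((M / h + 1 : ℕ) : ℝ) ≤ 3 * M / q := by
    have h1 : ((M / h : ℕ) : ℝ) ≤ M / h := Nat.cast_div_le
    have h2 : (q : ℝ) / 2 ≤ h := by
      rw [div_le_iff₀ (by norm_num)]
      exact_mod_cast (show q ≤ h * 2 by lia)
    have h3 : (M : ℝ) / h ≤ M / (q / 2) := by gcongr
    have h4 : (1 : ℝ) ≤ M / q := by rw [le_div_iff₀ (by linarith)]; linarith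
    have h5 : (M : ℝ) / (q / 2) = 2 * (M / q) := by field_simp
    push_cast
    rw [mul_div_assoc]
    linarith
  have hlog : Real.log q ≤ Real.log M := Real.log_le_log (by linarith) hqMR
  have hlog0 : 0 ≤ Real.log q := Real.log_nonneg hqR
  calc recipDistSum M α
      = ∑ i ∈ Finset.range (M / h + 1), ∑ m ∈ (Finset.Icc 1 M).filter (fun m => m / h = i),
          1 / distNearestInt (m * α) := by
        refine (Finset.sum_fiberwise_of_maps_to (fun m hm => ?_) _).symm
        exact Finset.mem_range_succ_iff.mpr (Nat.div_le_div_right (Finset.mem_Icc.mp hm).2)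
    _ ≤ ∑ _i ∈ Finset.range (M / h + 1),
          2 * (1 / distNearestInt (q * α) + 2 * q * (1 + Real.log q)) := Finset.sum_le_sum hblocks
    _ = ((M / h + 1 : ℕ) : ℝ) * (2 * (1 / distNearestInt (q * α) + 2 * q * (1 + Real.log q))) := by
        rw [Finset.sum_const, Finset.card_range, nsmul_eq_mul]
    _ ≤ 3 * M / q * (2 * (1 / distNearestInt (q * α) + 2 * q * (1 + Real.log M))) := by
        gcongr
    _ = M * (6 * (1 / (q * distNearestInt (q * α))) + 12 * (1 + Real.log M)) := by
        field_simp
        ring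

theorem exists_recipDistSum_le {α : ℝ} (hα : Irrational α) {M : ℕ} (hM : 1 ≤ M) :
    ∃ q, 1 ≤ q ∧ q ≤ M ∧ recipDistSum M α ≤
      M * (6 * (1 / (q * distNearestInt (q * α))) + 12 * (1 + Real.log M)) := by
  obtain ⟨q, hq, hmin⟩ := Finset.exists_min_image (Finset.Icc 1 M)
    (fun m : ℕ => distNearestInt (m * α)) ⟨1, Finset.mem_Icc.mpr ⟨le_rfl, hM⟩⟩
  rw [Finset.mem_Icc] at hq
  exact ⟨q, hq.1, hq.2, recipDistSum_le_of_minimal hα hq.1 hq.2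
    fun m h1 h2 => hmin m (Finset.mem_Icc.mpr ⟨h1, h2⟩)⟩

/-! ### The series and its weights -/

/-- The weight `log x · φ (log x)`. -/
noncomputable def logWeight (φ : ℝ → ℝ) (x : ℝ) : ℝ := Real.log x * φ (Real.log x)

theorem logWeight_pos {φ : ℝ → ℝ} (hφ_pos : ∀ x : ℝ, 0 < x → 0 < φ x) {x : ℝ} (hx : 1 < x) :
    0 < logWeight φ x :=
  mul_pos (Real.log_pos hx) (hφ_pos _ (Real.log_pos hx))

theorem logWeight_le {φ : ℝ → ℝ} (hφ_pos : ∀ x : ℝ, 0 < x → 0 < φ x)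
    (hφ_mono : MonotoneOn φ (Set.Ioi 0)) {x y : ℝ} (hx : 1 < x) (hxy : x ≤ y) :
    logWeight φ x ≤ logWeight φ y := by
  have h1 := Real.log_pos hx
  have h2 : Real.log x ≤ Real.log y := Real.log_le_log (by linarith) hxy
  exact mul_le_mul h2 (hφ_mono h1 (h1.trans_le h2) h2) (hφ_pos _ h1).le (h1.trans_le h2).le

theorem one_div_mul_antitoneOn {φ : ℝ → ℝ} (hφ_pos : ∀ x : ℝ, 0 < x → 0 < φ x)
    (hφ_mono : MonotoneOn φ (Set.Ioi 0)) :
    AntitoneOn (fun x => 1 / (x * φ x)) (Set.Ioi 0) := by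
  intro x hx y hy hxy
  exact one_div_le_one_div_of_le (mul_pos hx (hφ_pos x hx))
    (mul_le_mul hxy (hφ_mono hx hy hxy) (hφ_pos x hx).le (le_of_lt hy))

/-- After condensation the terms are `2^i g(a 2^i)`, and shifting `i` by one replaces `a` by `2a`.
This absorbs the factors `log 2` and `log 4` that appear when the logarithm of a power is compared
with its exponent. -/
theorem summable_of_summable_dilate {g : ℝ → ℝ} (hg : AntitoneOn g (Set.Ioi 0))
    (hg0 : ∀ x, 0 ≤ x → 0 ≤ g x) {a : ℝ} (ha : 0 < a)
    (h : Summable fun k : ℕ => g (2 * a * k)) : Summable fun k : ℕ => g (a * k) := by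
  have anti : ∀ b : ℝ, 0 < b → ∀ ⦃m n : ℕ⦄, 0 < m → m ≤ n → g (b * n) ≤ g (b * m) := by
    intro b hb m n hm hmn
    have hm' : (0 : ℝ) < m := by exact_mod_cast hm
    have hmn' : (m : ℝ) ≤ n := by exact_mod_cast hmn
    exact hg (mul_pos hb hm') (mul_pos hb (hm'.trans_le hmn')) (by gcongr)
  rw [← summable_condensed_iff_of_nonneg (fun n => hg0 _ (by positivity)) (anti _ (by positivity))]
    at h
  rw [← summable_condensed_iff_of_nonneg (fun n => hg0 _ (by positivity)) (anti _ ha),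
    ← summable_nat_add_iff 1]
  refine (h.mul_left 2).congr fun i => ?_
  push_cast
  rw [show a * (2 : ℝ) ^ (i + 1) = 2 * a * 2 ^ i by ring]
  ring

theorem summable_one_div_natCast_mul {φ : ℝ → ℝ} :
    (Summable fun k : ℕ => 1 / (((k : ℝ) + 1) * φ ((k : ℝ) + 1))) ↔
      Summable fun k : ℕ => 1 / ((k : ℝ) * φ k) := by
  rw [← summable_nat_add_iff 1 (f := fun k : ℕ => 1 / ((k : ℝ) * φ k))]
  push_cast
  rfl

/-- Condensation at `q = 2^k` leaves `1/(xφ(x))` with `x = k log 2`; since `log 2 ≥ 1/2`, the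
dilation by `1/2` dominates it. The maximum with 2 avoids `log 1 = 0`, where `φ` is uncontrolled. -/
theorem summable_one_div_mul_logWeight {φ : ℝ → ℝ} (hφ_pos : ∀ x : ℝ, 0 < x → 0 < φ x)
    (hφ_mono : MonotoneOn φ (Set.Ioi 0)) (h : Summable fun k : ℕ => 1 / ((k : ℝ) * φ k)) :
    Summable fun q : ℕ => 1 / ((q : ℝ) * logWeight φ (max q 2)) := by
  have hW : ∀ x : ℝ, 0 < logWeight φ (max x 2) := fun x =>
    logWeight_pos hφ_pos (lt_max_of_lt_right (by norm_num))
  have hanti := one_div_mul_antitoneOn hφ_pos hφ_mono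
  have hnonneg : ∀ x : ℝ, 0 ≤ x → 0 ≤ 1 / (x * φ x) := by
    intro x hx
    rcases hx.eq_or_lt with rfl | hx
    · simp
    · exact one_div_nonneg.mpr (mul_pos hx (hφ_pos x hx)).le
  rw [← summable_condensed_iff_of_nonneg
    (fun n => one_div_nonneg.mpr (mul_nonneg n.cast_nonneg (hW _).le))]
  · have h2 : Summable fun k : ℕ => 1 / ((1 / 2 * (k : ℝ)) * φ (1 / 2 * (k : ℝ))) := by
      refine summable_of_summable_dilate hanti hnonneg (by norm_num) ?_
      simpa using h
    rw [← summable_nat_add_iff 1] at h2 ⊢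
    refine h2.of_nonneg_of_le (fun k => ?_) (fun k => ?_)
    · have := hW ((2 ^ (k + 1) : ℕ) : ℝ)
      positivity
    · have hmax : max (((2 : ℕ) ^ (k + 1) : ℕ) : ℝ) 2 = 2 ^ (k + 1) := by
        push_cast
        refine max_eq_left ?_
        calc (2 : ℝ) = 2 ^ 1 := by norm_num
          _ ≤ 2 ^ (k + 1) := pow_le_pow_right₀ (by norm_num) (by lia)
      have hlog : Real.log ((2 : ℝ) ^ (k + 1)) = Real.log 2 * ((k + 1 : ℕ) : ℝ) := by
        rw [Real.log_pow, mul_comm]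
      rw [hmax]
      simp only [logWeight, hlog]
      have hk : (0 : ℝ) < ((k + 1 : ℕ) : ℝ) := by positivity
      have hl : 1 / 2 ≤ Real.log 2 := by have := Real.log_two_gt_d9; linarith
      calc (2 : ℝ) ^ (k + 1) * (1 / (((2 ^ (k + 1) : ℕ) : ℝ) * (Real.log 2 * ((k + 1 : ℕ) : ℝ) *
            φ (Real.log 2 * ((k + 1 : ℕ) : ℝ)))))
          = 1 / (Real.log 2 * ((k + 1 : ℕ) : ℝ) * φ (Real.log 2 * ((k + 1 : ℕ) : ℝ))) := by
            push_cast
            rw [mul_one_div, div_mul_eq_div_div, div_self (by positivity)]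
        _ ≤ _ := hanti (Set.mem_Ioi.mpr (by positivity)) (Set.mem_Ioi.mpr (by positivity))
            (by gcongr)
  · intro m n hm hmn
    have hm' : (0 : ℝ) < m := by exact_mod_cast hm
    have hmn' : (m : ℝ) ≤ n := by exact_mod_cast hmn
    refine one_div_le_one_div_of_le (mul_pos hm' (hW _)) ?_
    have := logWeight_le hφ_pos hφ_mono (x := max (m : ℝ) 2) (y := max (n : ℝ) 2)
      (lt_max_of_lt_right (by norm_num)) (max_le_max_right _ hmn')
    have := hW m
    gcongr

/-- A bounded `φ` would make the series dominate a multiple of the harmonic series. -/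
theorem tendsto_atTop_of_summable {φ : ℝ → ℝ} (hφ_pos : ∀ x : ℝ, 0 < x → 0 < φ x)
    (hφ_mono : MonotoneOn φ (Set.Ioi 0)) (h : Summable fun k : ℕ => 1 / ((k : ℝ) * φ k)) :
    Tendsto φ atTop atTop := by
  rw [tendsto_atTop]
  intro b
  obtain ⟨k, hk0, hk⟩ : ∃ k : ℕ, 0 < k ∧ b ≤ φ k := by
    by_contra! hcon
    have hb : 0 < b := (hφ_pos _ (by norm_num)).trans (hcon 1 one_pos)
    refine Real.not_summable_one_div_natCast ?_
    rw [← summable_mul_left_iff (a := 1 / b) (by positivity)]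
    refine h.of_nonneg_of_le (fun k => by positivity) (fun k => ?_)
    rcases Nat.eq_zero_or_pos k with rfl | hk
    · simp
    · have hk' : (0 : ℝ) < k := by exact_mod_cast hk
      rw [one_div_mul_one_div, mul_comm b]
      have := hφ_pos k hk'
      have := hcon k hk
      gcongr
  have hk' : (0 : ℝ) < k := by exact_mod_cast hk0
  filter_upwards [eventually_ge_atTop (k : ℝ)] with x hx
  exact hk.trans (hφ_mono hk' (hk'.trans_le hx) hx)

/-! ### The convergence case -/

theorem volume_distNearestInt_lt_le {q : ℕ} (hq : 1 ≤ q) {t : ℝ} (ht : 0 ≤ t) :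
    volume.restrict (Set.Ico (0 : ℝ) 1) {α | distNearestInt (q * α) < t} ≤
      ENNReal.ofReal (4 * t) := by
  have hqR : (1 : ℝ) ≤ q := by exact_mod_cast hq
  rw [Measure.restrict_apply' measurableSet_Ico]
  have hsub : {α : ℝ | distNearestInt (q * α) < t} ∩ Set.Ico 0 1 ⊆
      ⋃ p ∈ Finset.range (q + 1), Metric.ball ((p : ℝ) / q) (t / q) := by
    rintro α ⟨hα, h0, h1⟩
    have hlow : 0 ≤ round ((q : ℝ) * α) := by
      rw [round_eq, Int.floor_nonneg]; positivity
    have hup : round ((q : ℝ) * α) ≤ q := by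
      rw [round_eq, ← Int.lt_add_one_iff, Int.floor_lt]; push_cast; nlinarith
    obtain ⟨p, hp⟩ := Int.eq_ofNat_of_zero_le hlow
    refine Set.mem_iUnion₂.mpr ⟨p, Finset.mem_range.mpr (by lia), ?_⟩
    rw [Metric.mem_ball, Real.dist_eq]
    simp only [Set.mem_ofPred_eq, distNearestInt, hp] at hα
    rw [lt_div_iff₀ (by linarith), ← abs_of_pos (show (0 : ℝ) < q by linarith), ← abs_mul,
      abs_of_pos (show (0 : ℝ) < q by linarith)]
    rwa [sub_mul, div_mul_cancel₀ _ (by positivity), mul_comm α, ← Int.cast_natCast p]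
  calc _ ≤ volume (⋃ p ∈ Finset.range (q + 1), Metric.ball ((p : ℝ) / q) (t / q)) :=
        measure_mono hsub
    _ ≤ ∑ p ∈ Finset.range (q + 1), volume (Metric.ball ((p : ℝ) / q) (t / q)) :=
        measure_biUnion_finset_le _ _
    _ = ENNReal.ofReal ((q + 1) * (2 * (t / q))) := by
        simp only [Real.volume_ball, Finset.sum_const, Finset.card_range, nsmul_eq_mul]
        rw [← Nat.cast_succ, ENNReal.ofReal_mul (Nat.cast_nonneg _), ENNReal.ofReal_natCast]
    _ ≤ ENNReal.ofReal (4 * t) := by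
        refine ENNReal.ofReal_le_ofReal ?_
        rw [show ((q : ℝ) + 1) * (2 * (t / q)) = 2 * t * ((q + 1) / q) by ring]
        have : ((q : ℝ) + 1) / q ≤ 2 := by rw [div_le_iff₀ (by linarith)]; linarith
        nlinarith

/-- The exceptional sets have measure at most a constant times `1/(q W(q))`, so Borel–Cantelli
leaves finitely many bad `q` for almost every `α`; the constant `C` absorbs them. -/
theorem ae_exists_one_div_le {φ : ℝ → ℝ} (hφ_pos : ∀ x : ℝ, 0 < x → 0 < φ x)
    (hφ_mono : MonotoneOn φ (Set.Ioi 0)) (h : Summable fun k : ℕ => 1 / ((k : ℝ) * φ k))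
    {ε : ℝ} (hε : 0 < ε) :
    ∀ᵐ α ∂(volume.restrict (Set.Ico (0 : ℝ) 1)), ∃ C : ℝ, 0 ≤ C ∧ ∀ q : ℕ, 1 ≤ q →
      1 / (q * distNearestInt (q * α)) ≤ C + ε * logWeight φ (max q 2) := by
  have hW : ∀ x : ℝ, 0 < logWeight φ (max x 2) := fun x =>
    logWeight_pos hφ_pos (lt_max_of_lt_right (by norm_num))
  have hsum := summable_one_div_mul_logWeight hφ_pos hφ_mono h
  set s : ℕ → Set ℝ := fun q =>
    {α | 1 ≤ q ∧ distNearestInt (q * α) < ε⁻¹ * (1 / ((q : ℝ) * logWeight φ (max q 2)))} with hs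
  have hfin : ∑' q, volume.restrict (Set.Ico (0 : ℝ) 1) (s q) ≠ ⊤ := by
    have hle : ∀ q, volume.restrict (Set.Ico (0 : ℝ) 1) (s q) ≤
        ENNReal.ofReal (4 * (ε⁻¹ * (1 / ((q : ℝ) * logWeight φ (max q 2))))) := by
      intro q
      by_cases hq : 1 ≤ q
      · have := hW q
        refine (measure_mono ?_).trans (volume_distNearestInt_lt_le hq (by positivity))
        exact fun α hα => hα.2
      · simp [hs, hq]
    exact ((ENNReal.tsum_le_tsum hle).trans_lt
      ((hsum.mul_left ε⁻¹).mul_left 4).tsum_ofReal_lt_top).ne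
  filter_upwards [ae_eventually_notMem hfin] with α hα
  obtain ⟨Q, hQ⟩ := eventually_atTop.mp hα
  have hnn : ∀ q : ℕ, 0 ≤ 1 / ((q : ℝ) * distNearestInt (q * α)) := fun q =>
    one_div_nonneg.mpr (mul_nonneg q.cast_nonneg (distNearestInt_nonneg _))
  refine ⟨∑ q ∈ Finset.range Q, 1 / ((q : ℝ) * distNearestInt (q * α)),
    Finset.sum_nonneg fun q _ => hnn q, fun q hq => ?_⟩
  have hWq := hW q
  rcases lt_or_ge q Q with hlt | hge
  · have := Finset.single_le_sum (f := fun q : ℕ => 1 / ((q : ℝ) * distNearestInt (q * α)))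
      (fun i _ => hnn i) (Finset.mem_range.mpr hlt)
    have h2 : 0 ≤ ε * logWeight φ (max q 2) := by positivity
    linarith
  · have h1 := hQ q hge
    simp only [hs, Set.mem_ofPred_eq, not_and, not_lt] at h1
    have h2 := h1 hq
    have hqR : (0 : ℝ) < q := by exact_mod_cast hq
    have h3 : 1 / (q * distNearestInt (q * α)) ≤ ε * logWeight φ (max q 2) := by
      have h4 : 1 / (ε * logWeight φ (max q 2)) ≤ q * distNearestInt (q * α) := by
        calc 1 / (ε * logWeight φ (max q 2))
            = q * (ε⁻¹ * (1 / ((q : ℝ) * logWeight φ (max q 2)))) := by field_simp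
          _ ≤ _ := by gcongr
      have := one_div_le_one_div_of_le (by positivity) h4
      rwa [one_div_one_div] at this
    have := Finset.sum_nonneg fun q (_ : q ∈ Finset.range Q) => hnn q
    linarith

theorem ae_irrational (s : Set ℝ) : ∀ᵐ α ∂(volume.restrict s), Irrational α := by
  refine ae_restrict_of_ae ?_
  have : volume (Set.range ((↑) : ℚ → ℝ)) = 0 := (Set.countable_range _).measure_zero _
  exact measure_eq_zero_iff_ae_notMem.mp this

theorem recipDistSum_nonneg (M : ℕ) (α : ℝ) : 0 ≤ recipDistSum M α :=
  Finset.sum_nonneg fun _ _ => one_div_nonneg.mpr (distNearestInt_nonneg _)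

theorem ae_tendsto_zero_of_summable {φ : ℝ → ℝ} (hφ_pos : ∀ x : ℝ, 0 < x → 0 < φ x)
    (hφ_mono : MonotoneOn φ (Set.Ioi 0)) (h : Summable fun k : ℕ => 1 / ((k : ℝ) * φ k)) :
    ∀ᵐ α ∂(volume.restrict (Set.Ico (0 : ℝ) 1)), Tendsto
      (fun M : ℕ => recipDistSum M α / ((M : ℝ) * Real.log M) / φ (Real.log M)) atTop (𝓝 0) := by
  -- Only countably many values `ε = 1/(j+1)` are used, so one null set serves them all.
  have hall : ∀ᵐ α ∂(volume.restrict (Set.Ico (0 : ℝ) 1)), ∀ j : ℕ, ∃ C : ℝ, 0 ≤ C ∧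
      ∀ q : ℕ, 1 ≤ q → 1 / (q * distNearestInt (q * α)) ≤
        C + (1 / ((j : ℝ) + 1)) * logWeight φ (max q 2) :=
    ae_all_iff.mpr fun j => ae_exists_one_div_le hφ_pos hφ_mono h (by positivity)
  have hlog : Tendsto (fun M : ℕ => Real.log M) atTop atTop :=
    Real.tendsto_log_atTop.comp tendsto_natCast_atTop_atTop
  have hφ : Tendsto (fun M : ℕ => φ (Real.log M)) atTop atTop :=
    (tendsto_atTop_of_summable hφ_pos hφ_mono h).comp hlog
  have hG : Tendsto (fun M : ℕ => logWeight φ M) atTop atTop := hlog.atTop_mul_atTop₀ hφ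
  filter_upwards [hall, ae_irrational _] with α hα hirr
  have hnn : ∀ᶠ M : ℕ in atTop,
      0 ≤ recipDistSum M α / ((M : ℝ) * Real.log M) / φ (Real.log M) := by
    filter_upwards [eventually_ge_atTop 2] with M hM
    have hM' : (2 : ℝ) ≤ M := by exact_mod_cast hM
    have h1 := Real.log_pos (show (1 : ℝ) < M by linarith)
    have h2 := hφ_pos _ h1
    have h3 := recipDistSum_nonneg M α
    positivity
  refine (nhds_basis_Ioo_pos (0 : ℝ)).tendsto_right_iff.mpr fun ε hε => ?_
  obtain ⟨j, hj⟩ := exists_nat_one_div_lt (show 0 < ε / 6 by positivity)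
  obtain ⟨C, hC, hbound⟩ := hα j
  have hlim : Tendsto (fun M : ℕ => 6 * (1 / ((j : ℝ) + 1)) + (6 * C + 12) / logWeight φ M
      + 12 / φ (Real.log M)) atTop (𝓝 (6 * (1 / ((j : ℝ) + 1)) + 0 + 0)) :=
    (tendsto_const_nhds.add (hG.const_div_atTop _)).add (hφ.const_div_atTop _)
  have hlt : 6 * (1 / ((j : ℝ) + 1)) + 0 + 0 < ε := by linarith
  filter_upwards [hnn, hlim.eventually_lt_const hlt, eventually_ge_atTop 2] with M h0 hM hM2
  refine ⟨by linarith, (lt_of_le_of_lt ?_ hM).trans_eq (zero_add ε).symm⟩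
  have hM' : (2 : ℝ) ≤ M := by exact_mod_cast hM2
  have hl := Real.log_pos (show (1 : ℝ) < M by linarith)
  have hp := hφ_pos _ hl
  obtain ⟨q, hq1, hqM, hS⟩ := exists_recipDistSum_le hirr (show 1 ≤ M by lia)
  have hq2 : max (q : ℝ) 2 ≤ M := max_le (by exact_mod_cast hqM) hM'
  have hGq := logWeight_le hφ_pos hφ_mono (lt_max_of_lt_right (by norm_num)) hq2
  have hGM : logWeight φ M = Real.log M * φ (Real.log M) := rfl
  have hGpos := logWeight_pos hφ_pos (show (1 : ℝ) < M by linarith)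
  calc recipDistSum M α / ((M : ℝ) * Real.log M) / φ (Real.log M)
      = recipDistSum M α / (M * logWeight φ M) := by rw [hGM, div_div, mul_assoc]
    _ ≤ M * (6 * (C + 1 / ((j : ℝ) + 1) * logWeight φ M) + 12 * (1 + Real.log M)) /
          (M * logWeight φ M) := by
        gcongr
        refine hS.trans ?_
        have := hbound q hq1
        gcongr
        refine this.trans ?_
        gcongr
    _ = 6 * (1 / ((j : ℝ) + 1)) + (6 * C + 12) / logWeight φ M + 12 / φ (Real.log M) := by
        rw [hGM]
        field_simp
        ring

/-! ### Reduced fractions with denominators in `(N, 4N]` -/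

/-- Both sides count `∑ φ(d)` over pairs `d ∣ q ≤ L`, with `φ` here Euler's totient, since `∑_{d ∣
q} φ(d) = q`. -/
theorem sum_totient_mul_div (L : ℕ) :
    ∑ d ∈ Finset.Ioc 0 L, d.totient * (L / d) = ∑ q ∈ Finset.Ioc 0 L, q := by
  calc ∑ d ∈ Finset.Ioc 0 L, d.totient * (L / d)
      = ∑ d ∈ Finset.Ioc 0 L, ∑ q ∈ Finset.Ioc 0 L, if d ∣ q then d.totient else 0 := by
        refine Finset.sum_congr rfl fun d _ => ?_
        rw [← Finset.sum_filter, Finset.sum_const, Nat.Ioc_filter_dvd_card_eq_div, smul_eq_mul,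
          mul_comm]
    _ = ∑ q ∈ Finset.Ioc 0 L, ∑ d ∈ Finset.Ioc 0 L, if d ∣ q then d.totient else 0 :=
        Finset.sum_comm
    _ = ∑ q ∈ Finset.Ioc 0 L, q := by
        refine Finset.sum_congr rfl fun q hq => ?_
        rw [Finset.mem_Ioc] at hq
        rw [← Finset.sum_filter]
        conv_rhs => rw [← Nat.sum_totient q]
        refine Finset.sum_congr ?_ fun _ _ => rfl
        ext d
        simp only [Finset.mem_filter, Finset.mem_Ioc, Nat.mem_divisors]
        constructor
        · rintro ⟨_, h⟩
          exact ⟨h, by lia⟩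
        · rintro ⟨h, _⟩
          exact ⟨⟨Nat.pos_of_dvd_of_pos h hq.1, (Nat.le_of_dvd hq.1 h).trans hq.2⟩, h⟩

/-- Take `L = 4N` in `sum_totient_mul_div`: the total is at least `8N²`, the `d ≤ N` account for at
most `4N²`, and each `d > N` has weight `4N/d < 4`. The factor 4 in the range leaves this room. -/
theorem sq_le_sum_totient (N : ℕ) : N ^ 2 ≤ ∑ q ∈ Finset.Ioc N (4 * N), q.totient := by
  rcases Nat.eq_zero_or_pos N with rfl | hN
  · simp
  have hNR : (0 : ℝ) < N := by exact_mod_cast hN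
  have h1 : (8 * (N : ℝ) ^ 2) ≤ ∑ d ∈ Finset.Ioc 0 (4 * N), (4 * N : ℝ) * (d.totient / d) := by
    have hg : ((∑ q ∈ Finset.Ioc 0 (4 * N), q : ℕ) : ℝ) = 8 * N ^ 2 + 2 * N := by
      have hr : ∑ q ∈ Finset.Ioc 0 (4 * N), q = ∑ q ∈ Finset.range (4 * N + 1), q := by
        rw [Finset.range_eq_Ico, Finset.sum_eq_sum_Ico_succ_bot (by lia)]
        simp only [zero_add]
        refine Finset.sum_congr ?_ fun _ _ => rfl
        ext; simp; lia
      have hs := Finset.sum_range_id_mul_two (4 * N + 1)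
      rw [hr]
      have : (((∑ i ∈ Finset.range (4 * N + 1), i) * 2 : ℕ) : ℝ) = (4 * N + 1) * (4 * N) := by
        rw [hs]; push_cast; simp
      push_cast at this ⊢
      linarith
    rw [← sum_totient_mul_div] at hg
    calc 8 * (N : ℝ) ^ 2 ≤ 8 * N ^ 2 + 2 * N := by linarith
      _ = ∑ d ∈ Finset.Ioc 0 (4 * N), ((d.totient * (4 * N / d) : ℕ) : ℝ) := by
          rw [← hg, Nat.cast_sum]
      _ ≤ _ := by
          refine Finset.sum_le_sum fun d _ => ?_
          have h : ((4 * N / d : ℕ) : ℝ) ≤ (4 * N : ℕ) / d := Nat.cast_div_le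
          push_cast at h ⊢
          calc (d.totient : ℝ) * ((4 * N / d : ℕ) : ℝ) ≤ d.totient * (4 * N / d) := by gcongr
            _ = _ := by ring
  have hsplit : Finset.Ioc 0 (4 * N) = Finset.Ioc 0 N ∪ Finset.Ioc N (4 * N) :=
    (Finset.Ioc_union_Ioc_eq_Ioc (by lia) (by lia)).symm
  have hdisj : Disjoint (Finset.Ioc 0 N) (Finset.Ioc N (4 * N)) :=
    Finset.Ioc_disjoint_Ioc_of_le le_rfl
  rw [hsplit, Finset.sum_union hdisj] at h1
  have h2 : ∑ d ∈ Finset.Ioc 0 N, (4 * N : ℝ) * (d.totient / d) ≤ 4 * N ^ 2 := by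
    calc ∑ d ∈ Finset.Ioc 0 N, (4 * N : ℝ) * (d.totient / d)
        ≤ ∑ d ∈ Finset.Ioc 0 N, (4 * N : ℝ) * 1 := by
          refine Finset.sum_le_sum fun d hd => ?_
          have hd0 : (0 : ℝ) < d := by exact_mod_cast (Finset.mem_Ioc.mp hd).1
          have : (d.totient : ℝ) ≤ d := by exact_mod_cast Nat.totient_le d
          gcongr
          rwa [div_le_one hd0]
      _ = 4 * N ^ 2 := by simp; ring
  have h3 : ∑ d ∈ Finset.Ioc N (4 * N), (4 * N : ℝ) * (d.totient / d) ≤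
      ∑ d ∈ Finset.Ioc N (4 * N), 4 * (d.totient : ℝ) := by
    refine Finset.sum_le_sum fun d hd => ?_
    have hd0 : (N : ℝ) ≤ d := by exact_mod_cast (Finset.mem_Ioc.mp hd).1.le
    rw [mul_div_assoc', div_le_iff₀ (by linarith)]
    have : (0 : ℝ) ≤ d.totient := by positivity
    nlinarith
  rw [← Finset.mul_sum (Finset.Ioc N (4 * N)) (fun d => (d.totient : ℝ))] at h3
  have : (N : ℝ) ^ 2 ≤ ∑ d ∈ Finset.Ioc N (4 * N), (d.totient : ℝ) := by linarith
  exact_mod_cast this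

/-- The pairs `⟨q, a⟩` with `N < q ≤ 4N`, `0 ≤ a < q` and `gcd(a, q) = 1`. -/
def reducedPairs (N : ℕ) : Finset (Σ _ : ℕ, ℕ) :=
  (Finset.Ioc N (4 * N)).sigma fun q => (Finset.range q).filter (q.Coprime ·)

/-- The fraction `a / q` attached to `⟨q, a⟩`. -/
noncomputable def fracOf (c : Σ _ : ℕ, ℕ) : ℝ := c.2 / c.1

theorem mem_reducedPairs {N : ℕ} {c : Σ _ : ℕ, ℕ} :
    c ∈ reducedPairs N ↔ (N < c.1 ∧ c.1 ≤ 4 * N) ∧ c.2 < c.1 ∧ c.1.Coprime c.2 := by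
  simp [reducedPairs]

theorem card_reducedPairs (N : ℕ) :
    (reducedPairs N).card = ∑ q ∈ Finset.Ioc N (4 * N), q.totient := by
  rw [reducedPairs, Finset.card_sigma]
  rfl

theorem sq_le_card_reducedPairs (N : ℕ) : N ^ 2 ≤ (reducedPairs N).card :=
  (sq_le_sum_totient N).trans_eq (card_reducedPairs N).symm

theorem card_reducedPairs_le (N : ℕ) : (reducedPairs N).card ≤ 16 * N ^ 2 := by
  rw [card_reducedPairs]
  calc ∑ q ∈ Finset.Ioc N (4 * N), q.totient ≤ ∑ q ∈ Finset.Ioc N (4 * N), 4 * N :=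
        Finset.sum_le_sum fun q hq => (Nat.totient_le q).trans (Finset.mem_Ioc.mp hq).2
    _ = 12 * N ^ 2 := by
        rw [Finset.sum_const, Nat.card_Ioc, smul_eq_mul, show 4 * N - N = 3 * N by lia]; ring
    _ ≤ 16 * N ^ 2 := by gcongr; norm_num

theorem fracOf_mem_Ico {N : ℕ} {c : Σ _ : ℕ, ℕ} (hc : c ∈ reducedPairs N) :
    fracOf c ∈ Set.Ico (0 : ℝ) 1 := by
  obtain ⟨⟨h1, _⟩, h2, _⟩ := mem_reducedPairs.mp hc
  have hq : (0 : ℝ) < c.1 := by exact_mod_cast (by lia : 0 < c.1)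
  refine ⟨by unfold fracOf; positivity, ?_⟩
  rw [fracOf, div_lt_one hq]
  exact_mod_cast h2

/-- Distinct reduced fractions differ by a nonzero integer over `q q' ≤ 16N²`. -/
theorem separated_reducedPairs {N : ℕ} {c c' : Σ _ : ℕ, ℕ} (hc : c ∈ reducedPairs N)
    (hc' : c' ∈ reducedPairs N) (hne : c ≠ c') :
    1 / (16 * (N : ℝ) ^ 2) ≤ |fracOf c - fracOf c'| := by
  obtain ⟨q, a⟩ := c
  obtain ⟨q', a'⟩ := c'
  obtain ⟨⟨h1, h2⟩, h3, h4⟩ := mem_reducedPairs.mp hc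
  obtain ⟨⟨h1', h2'⟩, h3', h4'⟩ := mem_reducedPairs.mp hc'
  simp only at h1 h2 h3 h4 h1' h2' h3' h4'
  have hq : (0 : ℝ) < q := by exact_mod_cast (by lia : 0 < q)
  have hq' : (0 : ℝ) < q' := by exact_mod_cast (by lia : 0 < q')
  have hqN : (q : ℝ) ≤ 4 * N := by exact_mod_cast h2
  have hqN' : (q' : ℝ) ≤ 4 * N := by exact_mod_cast h2'
  have hz : (a : ℤ) * q' - q * a' ≠ 0 := by
    intro h0
    have h0' : a * q' = q * a' := by exact_mod_cast sub_eq_zero.mp h0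
    have d1 : q ∣ q' := h4.dvd_of_dvd_mul_left (Dvd.intro _ h0'.symm)
    have d2 : q' ∣ q := h4'.dvd_of_dvd_mul_right (Dvd.intro_left _ h0')
    obtain rfl := Nat.dvd_antisymm d1 d2
    rw [mul_comm] at h0'
    obtain rfl := Nat.eq_of_mul_eq_mul_left (by lia) h0'
    exact hne rfl
  have hz' : (1 : ℝ) ≤ |(((a : ℤ) * q' - q * a' : ℤ) : ℝ)| := by
    rw [← Int.cast_abs]
    exact_mod_cast Int.one_le_abs hz
  have e : fracOf ⟨q, a⟩ - fracOf ⟨q', a'⟩ = (((a : ℤ) * q' - q * a' : ℤ) : ℝ) / (q * q') := by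
    simp only [fracOf]
    rw [div_sub_div _ _ hq.ne' hq'.ne']
    push_cast
    rfl
  rw [e, abs_div, abs_of_pos (mul_pos hq hq')]
  have : (q : ℝ) * q' ≤ 16 * N ^ 2 := by nlinarith
  gcongr

/-- An interval of radius `ρ` holds at most `2 ρ / s + 1` points of an `s`-separated set. -/
theorem card_filter_abs_sub_lt_le {ι : Type*} (P : Finset ι) (f : ι → ℝ) {s ρ : ℝ} (x : ℝ)
    (hs : 0 < s) (hρ : 0 ≤ ρ) (hsep : ∀ i ∈ P, ∀ j ∈ P, i ≠ j → s ≤ |f i - f j|) :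
    ((P.filter fun i => |f i - x| < ρ).card : ℝ) ≤ 2 * ρ / s + 1 := by
  have hmem : ∀ i ∈ P.filter (fun i => |f i - x| < ρ), 0 ≤ (f i - (x - ρ)) / s ∧
      (f i - (x - ρ)) / s ≤ 2 * ρ / s := by
    intro i hi
    have := abs_lt.mp (Finset.mem_filter.mp hi).2
    constructor
    · exact div_nonneg (by linarith) hs.le
    · gcongr; linarith
  have hcard : (P.filter fun i => |f i - x| < ρ).card ≤ (Finset.range (⌊2 * ρ / s⌋₊ + 1)).card := by
    refine Finset.card_le_card_of_injOn (fun i => ⌊(f i - (x - ρ)) / s⌋₊) ?_ ?_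
    · intro i hi
      rw [Finset.coe_range, Set.mem_Iio, Nat.lt_succ_iff]
      exact Nat.floor_le_floor (hmem i hi).2
    · intro i hi j hj hij
      by_contra hne
      have h1 := hsep i (Finset.mem_filter.mp hi).1 j (Finset.mem_filter.mp hj).1 hne
      have a1 := Nat.floor_le (hmem i hi).1
      have a2 := Nat.lt_floor_add_one ((f i - (x - ρ)) / s)
      have b1 := Nat.floor_le (hmem j hj).1
      have b2 := Nat.lt_floor_add_one ((f j - (x - ρ)) / s)
      have e : (⌊(f i - (x - ρ)) / s⌋₊ : ℝ) = ⌊(f j - (x - ρ)) / s⌋₊ := by exact_mod_cast hij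
      have hlt : |(f i - (x - ρ)) / s - (f j - (x - ρ)) / s| < 1 := by
        rw [abs_lt]; constructor <;> linarith
      rw [← sub_div, abs_div, abs_of_pos hs, div_lt_one hs, sub_sub_sub_cancel_right] at hlt
      linarith
  rw [Finset.card_range] at hcard
  calc ((P.filter fun i => |f i - x| < ρ).card : ℝ) ≤ ((⌊2 * ρ / s⌋₊ + 1 : ℕ) : ℝ) := by
        exact_mod_cast hcard
    _ ≤ 2 * ρ / s + 1 := by
        push_cast
        have := Nat.floor_le (show 0 ≤ 2 * ρ / s by positivity)
        linarith

/-! ### The second moment method -/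

/-- The Chung–Erdős inequality. -/
theorem sq_sum_measureReal_le {Ω ι : Type*} [MeasurableSpace Ω] (μ : Measure Ω) [IsFiniteMeasure μ]
    (I : Finset ι) (A : ι → Set Ω) (hA : ∀ i ∈ I, MeasurableSet (A i)) :
    (∑ i ∈ I, μ.real (A i)) ^ 2 ≤
      μ.real (⋃ i ∈ I, A i) * ∑ i ∈ I, ∑ j ∈ I, μ.real (A i ∩ A j) := by
  classical
  set U := ⋃ i ∈ I, A i with hU
  have hUm : MeasurableSet U := Finset.measurableSet_biUnion I hA
  let ind : Set Ω → Ω → ℝ := fun s => s.indicator 1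
  have hint : ∀ s, MeasurableSet s → Integrable (ind s) μ := fun s hs =>
    (integrable_const (1 : ℝ)).indicator hs
  have hval : ∀ s, MeasurableSet s → ∫ x, ind s x ∂μ = μ.real s := fun s hs =>
    integral_indicator_one hs
  have hmul : ∀ s t x, ind s x * ind t x = ind (s ∩ t) x := by
    intro s t x
    simp only [ind, Set.indicator_apply, Set.mem_inter_iff, Pi.one_apply]
    split_ifs <;> simp_all
  -- Cauchy–Schwarz in discriminant form: the quadratic is the integral of `(∑ 1_{A_i} - l·1_U)²`,
  -- where `1_U` times any `1_{A_i}` is `1_{A_i}`.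
  have hquad : ∀ l : ℝ, 0 ≤ μ.real U * (l * l) + (-2 * ∑ i ∈ I, μ.real (A i)) * l +
      ∑ i ∈ I, ∑ j ∈ I, μ.real (A i ∩ A j) := by
    intro l
    have hexp : ∀ x, (∑ i ∈ I, ind (A i) x - l * ind U x) ^ 2 =
        ((l * l) * ind U x + (-2 * l) * ∑ i ∈ I, ind (A i) x) +
          ∑ i ∈ I, ∑ j ∈ I, ind (A i ∩ A j) x := by
      intro x
      have e1 : (∑ i ∈ I, ind (A i) x) * (∑ j ∈ I, ind (A j) x) =
          ∑ i ∈ I, ∑ j ∈ I, ind (A i ∩ A j) x := by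
        rw [Finset.sum_mul_sum]
        simp only [hmul]
      have e2 : (∑ i ∈ I, ind (A i) x) * ind U x = ∑ i ∈ I, ind (A i) x := by
        rw [Finset.sum_mul]
        refine Finset.sum_congr rfl fun i hi => ?_
        rw [hmul, Set.inter_eq_left.mpr]
        exact Set.subset_iUnion₂ (s := fun i (_ : i ∈ I) => A i) i hi
      have e3 : ind U x * ind U x = ind U x := by rw [hmul, Set.inter_self]
      linear_combination e1 - 2 * l * e2 + l ^ 2 * e3
    have h0 : 0 ≤ ∫ x, (∑ i ∈ I, ind (A i) x - l * ind U x) ^ 2 ∂μ :=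
      integral_nonneg fun x => sq_nonneg _
    simp only [hexp] at h0
    have i1 : Integrable (fun x => ∑ i ∈ I, ind (A i) x) μ :=
      integrable_finsetSum _ fun i hi => hint _ (hA i hi)
    have i2 : ∀ i ∈ I, Integrable (fun x => ∑ j ∈ I, ind (A i ∩ A j) x) μ := fun i hi =>
      integrable_finsetSum _ fun j hj => hint _ ((hA i hi).inter (hA j hj))
    have j1 : Integrable (fun x => l * l * ind U x) μ := (hint U hUm).const_mul _
    have j2 : Integrable (fun x => -2 * l * ∑ i ∈ I, ind (A i) x) μ := i1.const_mul _
    have j12 : Integrable (fun x => l * l * ind U x + -2 * l * ∑ i ∈ I, ind (A i) x) μ := j1.add j2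
    rw [integral_add j12 (integrable_finsetSum _ i2), integral_add j1 j2, integral_const_mul,
      integral_const_mul, hval U hUm, integral_finsetSum _ fun i hi => hint _ (hA i hi),
      integral_finsetSum _ i2] at h0
    rw [Finset.sum_congr rfl fun i hi => hval _ (hA i hi),
      Finset.sum_congr rfl fun i hi => (integral_finsetSum I fun j hj =>
        hint _ ((hA i hi).inter (hA j hj))).trans
        (Finset.sum_congr rfl fun j hj => hval _ ((hA i hi).inter (hA j hj)))] at h0
    linarith
  have := discrim_le_zero hquad
  rw [discrim] at this
  linarith

/-! ### Overlaps of balls around reduced fractions -/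

/-- The total length of the balls of radius `r n` around the fractions of the `n`-th block. -/
noncomputable def blockMass (r : ℕ → ℝ) (n : ℕ) : ℝ := (reducedPairs (4 ^ n)).card * (2 * r n)

theorem volume_real_ball_inter_le {a b : ℝ} {x y : ℝ} (hb : 0 ≤ b) :
    volume.real (Metric.ball x a ∩ Metric.ball y b) ≤ if |y - x| < a + b then 2 * b else 0 := by
  split_ifs with h
  · rw [← Real.volume_real_ball hb (a := y)]
    exact measureReal_mono Set.inter_subset_right
  · have : Metric.ball x a ∩ Metric.ball y b = ∅ := by
      rw [← Set.disjoint_iff_inter_eq_empty]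
      refine Metric.ball_disjoint_ball ?_
      rw [dist_comm, Real.dist_eq]
      exact not_lt.mp h
    simp [this]

/-- By separation, a ball of the coarser block `n` meets at most `64 r_n 16^m + 1` balls of block
`m`. The first term gives the product of the masses, as for independent events; the `+ 1` gives an
error decaying geometrically in `m - n`. -/
theorem sum_overlap_le {r : ℕ → ℝ} (hr : ∀ n, 0 < r n) (hanti : Antitone r) {n m : ℕ}
    (hnm : n ≤ m) :
    ∑ c ∈ reducedPairs (4 ^ n), ∑ c' ∈ reducedPairs (4 ^ m),
        volume.real (Metric.ball (fracOf c) (r n) ∩ Metric.ball (fracOf c') (r m)) ≤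
      32 * (blockMass r n * blockMass r m) + 16 * (1 / 16) ^ (m - n) * blockMass r m := by
  have hrn := hr n
  have hrm := hr m
  have hle := hanti hnm
  have hm4 : (0 : ℝ) < 4 ^ m := by positivity
  have inner : ∀ c ∈ reducedPairs (4 ^ n), ∑ c' ∈ reducedPairs (4 ^ m),
      volume.real (Metric.ball (fracOf c) (r n) ∩ Metric.ball (fracOf c') (r m)) ≤
      (64 * r n * (4 ^ m) ^ 2 + 1) * (2 * r m) := by
    intro c _
    calc _ ≤ ∑ c' ∈ reducedPairs (4 ^ m),
          if |fracOf c' - fracOf c| < r n + r m then 2 * r m else 0 :=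
          Finset.sum_le_sum fun c' _ => volume_real_ball_inter_le hrm.le
      _ = (((reducedPairs (4 ^ m)).filter
            fun c' => |fracOf c' - fracOf c| < r n + r m).card : ℝ) * (2 * r m) := by
          rw [← Finset.sum_filter, Finset.sum_const, nsmul_eq_mul]
      _ ≤ (2 * (r n + r m) / (1 / (16 * (4 ^ m) ^ 2)) + 1) * (2 * r m) := by
          gcongr
          refine card_filter_abs_sub_lt_le _ fracOf _ (by positivity) (by positivity) ?_
          intro i hi j hj hij
          have := separated_reducedPairs hi hj hij
          push_cast at this
          exact this
      _ ≤ (64 * r n * (4 ^ m) ^ 2 + 1) * (2 * r m) := by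
          rw [div_div_eq_mul_div, div_one]
          refine mul_le_mul_of_nonneg_right ?_ (by positivity)
          have : (0 : ℝ) ≤ (4 ^ m) ^ 2 := by positivity
          nlinarith
  have hcm : ((4 : ℝ) ^ m) ^ 2 ≤ (reducedPairs (4 ^ m)).card := by
    exact_mod_cast sq_le_card_reducedPairs (4 ^ m)
  have hcn : ((reducedPairs (4 ^ n)).card : ℝ) ≤ 16 * (4 ^ n) ^ 2 := by
    exact_mod_cast card_reducedPairs_le (4 ^ n)
  have hpow : ((4 : ℝ) ^ n) ^ 2 = (1 / 16) ^ (m - n) * (4 ^ m) ^ 2 := by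
    obtain ⟨k, rfl⟩ := Nat.exists_eq_add_of_le hnm
    rw [Nat.add_sub_cancel_left, pow_add, mul_pow, ← pow_mul, ← pow_mul 4 k, mul_comm k 2,
      pow_mul 4 2 k, mul_left_comm, ← mul_pow]
    norm_num
  have hmass : ((4 : ℝ) ^ m) ^ 2 * (2 * r m) ≤ blockMass r m := by
    unfold blockMass; gcongr
  calc _ ≤ ∑ c ∈ reducedPairs (4 ^ n), (64 * r n * (4 ^ m) ^ 2 + 1) * (2 * r m) :=
        Finset.sum_le_sum inner
    _ = 32 * (blockMass r n * ((4 ^ m) ^ 2 * (2 * r m))) +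
          (reducedPairs (4 ^ n)).card * (2 * r m) := by
        rw [Finset.sum_const, nsmul_eq_mul, blockMass]; ring
    _ ≤ 32 * (blockMass r n * blockMass r m) + 16 * (4 ^ n) ^ 2 * (2 * r m) := by
        have : 0 ≤ blockMass r n := by unfold blockMass; positivity
        gcongr
    _ = 32 * (blockMass r n * blockMass r m) +
          16 * (1 / 16) ^ (m - n) * ((4 ^ m) ^ 2 * (2 * r m)) := by rw [hpow]; ring
    _ ≤ _ := by gcongr

theorem sum_geometric_tail_le (s : Finset ℕ) (m : ℕ) :
    ∑ n ∈ s, (if n ≤ m then 16 * (1 / 16 : ℝ) ^ (m - n) else 0) ≤ 32 := by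
  have h0 : ∀ n, 0 ≤ (if n ≤ m then 16 * (1 / 16 : ℝ) ^ (m - n) else 0) := fun n => by
    split_ifs <;> positivity
  calc ∑ n ∈ s, (if n ≤ m then 16 * (1 / 16 : ℝ) ^ (m - n) else 0)
      = ∑ n ∈ s.filter (· ≤ m), 16 * (1 / 16 : ℝ) ^ (m - n) := by rw [Finset.sum_filter]
    _ ≤ ∑ n ∈ Finset.range (m + 1), 16 * (1 / 16 : ℝ) ^ (m - n) := by
        refine Finset.sum_le_sum_of_subset_of_nonneg ?_ fun _ _ _ => by positivity
        intro n hn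
        rw [Finset.mem_filter] at hn
        exact Finset.mem_range_succ_iff.mpr hn.2
    _ = ∑ n ∈ Finset.range (m + 1), 16 * (1 / 16 : ℝ) ^ n := by
        rw [← Finset.sum_range_reflect]
        refine Finset.sum_congr rfl fun n hn => ?_
        rw [Finset.mem_range] at hn
        congr 2
        lia
    _ ≤ 16 * ∑' n : ℕ, (1 / 16 : ℝ) ^ n := by
        rw [← Finset.mul_sum]
        gcongr
        exact (summable_geometric_of_lt_one (by norm_num) (by norm_num)).sum_le_tsum _
          fun _ _ => by positivity
    _ ≤ 32 := by rw [tsum_geometric_of_lt_one (by norm_num) (by norm_num)]; norm_num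

/-! ### Measure of the limsup set of the balls -/

theorem le_measure_iUnion_balls {r : ℕ → ℝ} (hr : ∀ n, 0 < r n) (hr1 : ∀ n, r n ≤ 1)
    (hanti : Antitone r) (s : Finset ℕ) (hs : 1 ≤ ∑ n ∈ s, blockMass r n) :
    1 / 128 ≤ (volume.restrict (Set.Ioo (-1 : ℝ) 2)).real
      (⋃ n ∈ s, ⋃ c ∈ reducedPairs (4 ^ n), Metric.ball (fracOf c) (r n)) := by
  -- A finite measure that still gives every ball its full length: centres lie in `[0, 1)` and radii
  -- are at most 1.
  set μ := volume.restrict (Set.Ioo (-1 : ℝ) 2) with hμ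
  set S := ∑ n ∈ s, blockMass r n with hS
  let I : Finset (Σ _ : ℕ, Σ _ : ℕ, ℕ) := s.sigma fun n => reducedPairs (4 ^ n)
  let A : (Σ _ : ℕ, Σ _ : ℕ, ℕ) → Set ℝ := fun i => Metric.ball (fracOf i.2) (r i.1)
  have hA : ∀ n, ∀ c ∈ reducedPairs (4 ^ n), μ.real (Metric.ball (fracOf c) (r n)) = 2 * r n := by
    intro n c hc
    have hc' := fracOf_mem_Ico hc
    rw [hμ, measureReal_restrict_apply Metric.isOpen_ball.measurableSet, Set.inter_eq_left.mpr,
      Real.volume_real_ball (hr n).le]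
    rw [Real.ball_eq_Ioo]
    have := hr1 n
    exact Set.Ioo_subset_Ioo (by linarith [hc'.1]) (by linarith [hc'.2])
  have hsum : ∑ i ∈ I, μ.real (A i) = S := by
    rw [Finset.sum_sigma]
    refine Finset.sum_congr rfl fun n _ => ?_
    rw [Finset.sum_congr rfl (hA n), Finset.sum_const, nsmul_eq_mul, blockMass]
  have hres : ∀ t : Set ℝ, MeasurableSet t → volume t ≠ ⊤ → μ.real t ≤ volume.real t := by
    intro t ht hfin
    rw [hμ, measureReal_restrict_apply ht]
    exact measureReal_mono Set.inter_subset_left hfin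
  let e : ℕ → ℕ → ℝ := fun n m => (if n ≤ m then 16 * (1 / 16 : ℝ) ^ (m - n) else 0) *
    blockMass r m
  have hmass : ∀ n, 0 ≤ blockMass r n := fun n => by
    have := hr n
    unfold blockMass; positivity
  have he : ∀ n m, 0 ≤ e n m := fun n m => by
    refine mul_nonneg ?_ (hmass m)
    split_ifs <;> positivity
  have hQ : ∀ n m, ∑ c ∈ reducedPairs (4 ^ n), ∑ c' ∈ reducedPairs (4 ^ m),
      μ.real (Metric.ball (fracOf c) (r n) ∩ Metric.ball (fracOf c') (r m)) ≤
      32 * (blockMass r n * blockMass r m) + (e n m + e m n) := by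
    have hle : ∀ n m, n ≤ m → ∑ c ∈ reducedPairs (4 ^ n), ∑ c' ∈ reducedPairs (4 ^ m),
        μ.real (Metric.ball (fracOf c) (r n) ∩ Metric.ball (fracOf c') (r m)) ≤
        32 * (blockMass r n * blockMass r m) + e n m := by
      intro n m hnm
      refine (Finset.sum_le_sum fun c _ => Finset.sum_le_sum fun c' _ => hres _
        (Metric.isOpen_ball.measurableSet.inter Metric.isOpen_ball.measurableSet)
        ?_).trans ((sum_overlap_le hr hanti hnm).trans_eq ?_)
      · exact ((measure_mono Set.inter_subset_left).trans_lt measure_ball_lt_top).ne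
      · simp only [e, if_pos hnm]
    intro n m
    rcases le_total n m with h | h
    · linarith [hle n m h, he m n]
    · rw [Finset.sum_comm]
      have := hle m n h
      simp only [Set.inter_comm] at this ⊢
      linarith [he n m]
  have hesum : ∑ n ∈ s, ∑ m ∈ s, e n m ≤ 32 * S := by
    rw [Finset.sum_comm, hS, Finset.mul_sum]
    refine Finset.sum_le_sum fun m _ => ?_
    rw [← Finset.sum_mul]
    exact mul_le_mul_of_nonneg_right (sum_geometric_tail_le s m) (hmass m)
  -- The error terms total at most `64 S`, and `S ≥ 1` lets `S²` absorb them.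
  have hdouble : ∑ i ∈ I, ∑ j ∈ I, μ.real (A i ∩ A j) ≤ 128 * S ^ 2 := by
    calc ∑ i ∈ I, ∑ j ∈ I, μ.real (A i ∩ A j)
        = ∑ n ∈ s, ∑ m ∈ s, ∑ c ∈ reducedPairs (4 ^ n), ∑ c' ∈ reducedPairs (4 ^ m),
            μ.real (Metric.ball (fracOf c) (r n) ∩ Metric.ball (fracOf c') (r m)) := by
          rw [Finset.sum_sigma]
          refine Finset.sum_congr rfl fun n _ => ?_
          rw [Finset.sum_comm (s := s)]
          refine Finset.sum_congr rfl fun c _ => ?_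
          rw [Finset.sum_sigma]
      _ ≤ ∑ n ∈ s, ∑ m ∈ s, (32 * (blockMass r n * blockMass r m) + (e n m + e m n)) :=
          Finset.sum_le_sum fun n _ => Finset.sum_le_sum fun m _ => hQ n m
      _ = 32 * S ^ 2 + (∑ n ∈ s, ∑ m ∈ s, e n m + ∑ n ∈ s, ∑ m ∈ s, e n m) := by
          simp only [Finset.sum_add_distrib]
          congr 1
          · rw [hS, sq, Finset.sum_mul_sum]
            simp only [Finset.mul_sum]
          · congr 1
            exact Finset.sum_comm
      _ ≤ 128 * S ^ 2 := by nlinarith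
  have hCE := sq_sum_measureReal_le μ I A fun i _ => Metric.isOpen_ball.measurableSet
  have hU : (⋃ i ∈ I, A i) =
      ⋃ n ∈ s, ⋃ c ∈ reducedPairs (4 ^ n), Metric.ball (fracOf c) (r n) := by
    ext x
    simp only [Set.mem_iUnion, I, A, Finset.mem_sigma, Sigma.exists, exists_prop]
    constructor
    · rintro ⟨n, q, a, ⟨h1, h2⟩, h3⟩
      exact ⟨n, h1, q, a, h2, h3⟩
    · rintro ⟨n, h1, q, a, h2, h3⟩
      exact ⟨n, q, a, ⟨h1, h2⟩, h3⟩
  rw [hsum, hU] at hCE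
  have hm0 := measureReal_nonneg (μ := μ)
    (s := ⋃ n ∈ s, ⋃ c ∈ reducedPairs (4 ^ n), Metric.ball (fracOf c) (r n))
  have hfin := hCE.trans (mul_le_mul_of_nonneg_left hdouble hm0)
  have hSpos : 0 < S ^ 2 := by positivity
  rw [div_le_iff₀ (by norm_num)]
  nlinarith

/-- Divergence gives every tail of blocks a finite piece of mass at least 1, so all tail unions have
measure at least `1/128`; continuity from above passes this to their intersection. -/
theorem volume_frequently_ne_zero {r : ℕ → ℝ} (hr : ∀ n, 0 < r n) (hr1 : ∀ n, r n ≤ 1)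
    (hanti : Antitone r) (hdiv : ¬ Summable fun n : ℕ => (16 : ℝ) ^ n * r n) :
    volume {x : ℝ | ∃ᶠ n in atTop, ∃ c ∈ reducedPairs (4 ^ n), |x - fracOf c| < r n} ≠ 0 := by
  set μ := volume.restrict (Set.Ioo (-1 : ℝ) 2) with hμ
  let E : ℕ → Set ℝ := fun n => ⋃ c ∈ reducedPairs (4 ^ n), Metric.ball (fracOf c) (r n)
  let W : ℕ → Set ℝ := fun k => ⋃ n ∈ Set.Ici k, E n
  have hmassnn : ∀ n, 0 ≤ blockMass r n := fun n => by
    have := hr n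
    unfold blockMass; positivity
  have hmass : ¬ Summable (blockMass r) := by
    refine fun h => hdiv (h.of_nonneg_of_le (fun n => ?_) fun n => ?_)
    · have := hr n
      positivity
    · have h1 : ((4 : ℝ) ^ n) ^ 2 ≤ (reducedPairs (4 ^ n)).card := by
        exact_mod_cast sq_le_card_reducedPairs (4 ^ n)
      have h2 : (16 : ℝ) ^ n = (4 ^ n) ^ 2 := by rw [← pow_mul, mul_comm n, pow_mul]; norm_num
      have := hr n
      rw [h2, blockMass]
      gcongr
      linarith
  have hW : ∀ k, ENNReal.ofReal (1 / 128) ≤ μ (W k) := by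
    intro k
    have hk : ¬ Summable fun n => blockMass r (n + k) := by rwa [summable_nat_add_iff k]
    rw [not_summable_iff_tendsto_nat_atTop_of_nonneg fun n => hmassnn _] at hk
    obtain ⟨X, hX⟩ := (hk.eventually_ge_atTop 1).exists
    have h1 := le_measure_iUnion_balls hr hr1 hanti (Finset.Ico k (k + X)) (by
      rw [Finset.sum_Ico_eq_sum_range, Nat.add_sub_cancel_left]
      simpa only [add_comm k] using hX)
    calc ENNReal.ofReal (1 / 128) ≤ ENNReal.ofReal (μ.real (⋃ n ∈ Finset.Ico k (k + X), E n)) :=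
          ENNReal.ofReal_le_ofReal h1
      _ = μ (⋃ n ∈ Finset.Ico k (k + X), E n) := ofReal_measureReal (measure_ne_top _ _)
      _ ≤ μ (W k) := by
          refine measure_mono (Set.biUnion_mono (fun n hn => ?_) fun _ _ => subset_rfl)
          exact (Finset.mem_Ico.mp hn).1
  have hWanti : Antitone W := fun k l hkl =>
    Set.biUnion_mono (Set.Ici_subset_Ici.mpr hkl) fun _ _ => subset_rfl
  have hWm : ∀ k, MeasurableSet (W k) := fun k =>
    (isOpen_biUnion fun n _ => isOpen_biUnion fun c _ => Metric.isOpen_ball).measurableSet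
  have hlim := tendsto_measure_iInter_atTop (μ := μ) (fun k => (hWm k).nullMeasurableSet) hWanti
    ⟨0, measure_ne_top _ _⟩
  have hge := ge_of_tendsto' hlim hW
  have hsub : (⋂ k, W k) ⊆
      {x : ℝ | ∃ᶠ n in atTop, ∃ c ∈ reducedPairs (4 ^ n), |x - fracOf c| < r n} := by
    intro x hx
    refine frequently_atTop.mpr fun k => ?_
    obtain ⟨n, hn, hxn⟩ := Set.mem_iUnion₂.mp (Set.mem_iInter.mp hx k)
    obtain ⟨c, hc, hxc⟩ := Set.mem_iUnion₂.mp hxn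
    exact ⟨n, hn, c, hc, hxc⟩
  intro h0
  have : μ (⋂ k, W k) = 0 :=
    le_antisymm ((Measure.restrict_apply_le _ _).trans ((measure_mono hsub).trans h0.le)) zero_le
  rw [this] at hge
  norm_num at hge

/-! ### Khinchin's theorem in the divergence case -/

/-- The zero-one law lives on the circle and the counting on the line. The line is a countable union
of intervals `(n, n+1]`, on each of which the projection preserves measure. -/
theorem ae_real_of_ae_unitAddCircle {s : Set UnitAddCircle} (h : ∀ᵐ y : UnitAddCircle, y ∈ s) :
    ∀ᵐ x : ℝ, (x : UnitAddCircle) ∈ s := by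
  rw [← Measure.restrict_univ (μ := (volume : Measure ℝ)), ← iUnion_Ioc_intCast ℝ,
    ae_restrict_iUnion_iff]
  intro n
  exact (UnitAddCircle.measurePreserving_mk (n : ℝ)).quasiMeasurePreserving.ae h

/-- The radius `1 / (K q² log q φ(log q))`, with `log q` replaced by `log 2` for `q ≤ 2`. -/
noncomputable def khinchinRadius (φ : ℝ → ℝ) (K : ℝ) (q : ℕ) : ℝ :=
  1 / (K * (q : ℝ) ^ 2 * logWeight φ (max q 2))

theorem khinchinRadius_pos {φ : ℝ → ℝ} (hφ_pos : ∀ x : ℝ, 0 < x → 0 < φ x) {K : ℝ} (hK : 0 < K)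
    {q : ℕ} (hq : 1 ≤ q) : 0 < khinchinRadius φ K q := by
  have hq' : (0 : ℝ) < q := by exact_mod_cast hq
  have : 0 < logWeight φ (max q 2) := logWeight_pos hφ_pos (lt_max_of_lt_right (by norm_num))
  unfold khinchinRadius
  positivity

theorem khinchinRadius_le {φ : ℝ → ℝ} (hφ_pos : ∀ x : ℝ, 0 < x → 0 < φ x)
    (hφ_mono : MonotoneOn φ (Set.Ioi 0)) {K : ℝ} (hK : 0 < K) {q q' : ℕ} (hq : 1 ≤ q)
    (hqq : q ≤ q') : khinchinRadius φ K q' ≤ khinchinRadius φ K q := by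
  have hq' : (0 : ℝ) < q := by exact_mod_cast hq
  have hqq' : (q : ℝ) ≤ q' := by exact_mod_cast hqq
  have h1 : 1 < max (q : ℝ) 2 := lt_max_of_lt_right (by norm_num)
  have h2 := logWeight_pos hφ_pos h1
  have h3 := logWeight_le hφ_pos hφ_mono h1 (max_le_max_right 2 hqq')
  unfold khinchinRadius
  gcongr

theorem tendsto_khinchinRadius {φ : ℝ → ℝ} (hφ_pos : ∀ x : ℝ, 0 < x → 0 < φ x)
    (hφ_mono : MonotoneOn φ (Set.Ioi 0)) {K : ℝ} (hK : 0 < K) :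
    Tendsto (khinchinRadius φ K) atTop (𝓝 0) := by
  have hc : 0 < K * logWeight φ 2 := mul_pos hK (logWeight_pos hφ_pos (by norm_num))
  have hlim : Tendsto (fun q : ℕ => (1 / (K * logWeight φ 2)) / (q : ℝ)) atTop (𝓝 0) :=
    tendsto_const_div_atTop_nhds_zero_nat _
  refine squeeze_zero' ?_ ?_ hlim
  · filter_upwards [eventually_ge_atTop 1] with q hq
    exact (khinchinRadius_pos hφ_pos hK hq).le
  · filter_upwards [eventually_ge_atTop 1] with q hq
    have hq' : (1 : ℝ) ≤ q := by exact_mod_cast hq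
    have h2 := logWeight_le hφ_pos hφ_mono (x := 2) (by norm_num) (le_max_right (q : ℝ) 2)
    rw [div_div, khinchinRadius]
    refine one_div_le_one_div_of_le (by positivity) ?_
    calc K * logWeight φ 2 * q = K * q * logWeight φ 2 := by ring
      _ ≤ K * (q : ℝ) ^ 2 * logWeight φ (max q 2) := by
        have := logWeight_pos hφ_pos (x := 2) (by norm_num)
        have : (q : ℝ) ≤ (q : ℝ) ^ 2 := by nlinarith
        gcongr

theorem not_summable_khinchinRadius {φ : ℝ → ℝ} (hφ_pos : ∀ x : ℝ, 0 < x → 0 < φ x)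
    (hφ_mono : MonotoneOn φ (Set.Ioi 0)) (h : ¬ Summable fun k : ℕ => 1 / ((k : ℝ) * φ k))
    {K : ℝ} (hK : 0 < K) :
    ¬ Summable fun n : ℕ => (16 : ℝ) ^ n * khinchinRadius φ K (4 ^ (n + 1)) := by
  intro hs
  apply h
  have hanti := one_div_mul_antitoneOn hφ_pos hφ_mono
  have hnonneg : ∀ x : ℝ, 0 ≤ x → 0 ≤ 1 / (x * φ x) := by
    intro x hx
    rcases hx.eq_or_lt with rfl | hx
    · simp
    · exact one_div_nonneg.mpr (mul_pos hx (hφ_pos x hx)).le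
  suffices h2 : Summable fun k : ℕ => 1 / ((2 * 1 * (k : ℝ)) * φ (2 * 1 * (k : ℝ))) by
    simpa using summable_of_summable_dilate hanti hnonneg one_pos h2
  rw [← summable_nat_add_iff 1]
  refine (hs.mul_left (16 * K)).of_nonneg_of_le (fun n => hnonneg _ (by positivity)) fun n => ?_
  have hmax : max (((4 : ℕ) ^ (n + 1) : ℕ) : ℝ) 2 = 4 ^ (n + 1) := by
    push_cast
    refine max_eq_left ?_
    calc (2 : ℝ) ≤ 4 ^ 1 := by norm_num
      _ ≤ 4 ^ (n + 1) := pow_le_pow_right₀ (by norm_num) (by lia)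
  have hlog : Real.log ((4 : ℝ) ^ (n + 1)) = Real.log 4 * ((n + 1 : ℕ) : ℝ) := by
    rw [Real.log_pow, mul_comm]
  have hn : (0 : ℝ) < ((n + 1 : ℕ) : ℝ) := by positivity
  have hl4 : Real.log 4 = 2 * Real.log 2 := by
    rw [show (4 : ℝ) = 2 ^ 2 by norm_num, Real.log_pow]; norm_num
  have hl : Real.log 4 ≤ 2 * 1 := by have := Real.log_two_lt_d9; linarith
  have hl0 : 0 < Real.log 4 := Real.log_pos (by norm_num)
  have h16 : (((4 : ℕ) ^ (n + 1) : ℕ) : ℝ) ^ 2 = 16 * 16 ^ n := by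
    push_cast
    rw [← pow_mul, mul_comm, pow_mul, pow_succ]
    norm_num [mul_comm]
  calc _ ≤ 1 / (Real.log 4 * ((n + 1 : ℕ) : ℝ) * φ (Real.log 4 * ((n + 1 : ℕ) : ℝ))) :=
        hanti (Set.mem_Ioi.mpr (by positivity)) (Set.mem_Ioi.mpr (by positivity)) (by gcongr)
    _ = 16 * K * (16 ^ n * khinchinRadius φ K (4 ^ (n + 1))) := by
        rw [khinchinRadius, hmax, h16, logWeight, hlog]
        have := hφ_pos (Real.log 4 * ((n + 1 : ℕ) : ℝ)) (by positivity)
        field_simp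

theorem ae_mem_addWellApproximable {φ : ℝ → ℝ} (hφ_pos : ∀ x : ℝ, 0 < x → 0 < φ x)
    (hφ_mono : MonotoneOn φ (Set.Ioi 0)) (h : ¬ Summable fun k : ℕ => 1 / ((k : ℝ) * φ k))
    {K : ℝ} (hK : 0 < K) :
    ∀ᵐ x : ℝ, (x : UnitAddCircle) ∈ addWellApproximable UnitAddCircle (khinchinRadius φ K) := by
  refine ae_real_of_ae_unitAddCircle ((AddCircle.addWellApproximable_ae_empty_or_univ _
    (tendsto_khinchinRadius hφ_pos hφ_mono hK)).resolve_left fun hempty => ?_)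
  have hnull := ae_real_of_ae_unitAddCircle
    (s := (addWellApproximable UnitAddCircle (khinchinRadius φ K))ᶜ) hempty
  -- One radius per block, the smallest one allowed there, so that it is valid for every denominator
  -- up to `4^(n+1)`. The cap at 1 is inactive for large `n`.
  set r : ℕ → ℝ := fun n => min (khinchinRadius φ K (4 ^ (n + 1))) 1 with hr
  have h4 : ∀ n, 1 ≤ 4 ^ (n + 1) := fun n => Nat.one_le_pow _ _ (by norm_num)
  have hanti : Antitone r := fun n m hnm => min_le_min_right _ <|
    khinchinRadius_le hφ_pos hφ_mono hK (h4 n) (Nat.pow_le_pow_right (by norm_num) (by lia))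
  have hlim : Tendsto (fun n : ℕ => khinchinRadius φ K (4 ^ (n + 1))) atTop (𝓝 0) :=
    (tendsto_khinchinRadius hφ_pos hφ_mono hK).comp
      ((tendsto_pow_atTop_atTop_of_one_lt (by norm_num : 1 < 4)).comp (tendsto_add_atTop_nat 1))
  have hdiv : ¬ Summable fun n : ℕ => (16 : ℝ) ^ n * r n := by
    refine fun hs => not_summable_khinchinRadius hφ_pos hφ_mono h hK ?_
    refine (summable_congr_atTop ?_).mp hs
    filter_upwards [hlim.eventually_le_const one_pos] with n hn
    rw [hr]
    simp only [min_eq_left hn]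
  refine volume_frequently_ne_zero (fun n => lt_min (khinchinRadius_pos hφ_pos hK (h4 n)) one_pos)
    (fun n => min_le_right _ _) hanti hdiv ?_
  refine measure_mono_null (fun x hx => ?_) hnull
  rw [Set.mem_compl_iff, Set.mem_ofPred_eq, Set.mem_compl_iff, not_not,
    UnitAddCircle.mem_addWellApproximable_iff]
  refine Set.infinite_of_forall_exists_gt fun k => ?_
  obtain ⟨n, hn, c, hc, hxc⟩ := frequently_atTop.mp hx k
  obtain ⟨⟨h1, h2⟩, h3, h5⟩ := mem_reducedPairs.mp hc
  have hkn : k < 4 ^ n := hn.trans_lt (Nat.lt_pow_self (by norm_num))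
  refine ⟨c.1, ⟨c.2, h3, h5.symm, ?_⟩, hkn.trans h1⟩
  rw [← AddCircle.coe_sub, UnitAddCircle.norm_eq]
  calc |x - (c.2 : ℝ) / c.1 - round (x - (c.2 : ℝ) / c.1)| ≤ |x - (c.2 : ℝ) / c.1 - (0 : ℤ)| :=
        round_le _ _
    _ = |x - fracOf c| := by simp [fracOf]
    _ < r n := hxc
    _ ≤ khinchinRadius φ K (4 ^ (n + 1)) := min_le_left _ _
    _ ≤ khinchinRadius φ K c.1 :=
        khinchinRadius_le hφ_pos hφ_mono hK (by lia) (h2.trans_eq (by ring))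

/-! ### Large sums from good approximations -/

theorem frequently_lt_of_mem_addWellApproximable {φ : ℝ → ℝ}
    (hφ_pos : ∀ x : ℝ, 0 < x → 0 < φ x) {K : ℝ} (hK : 0 < K) {α : ℝ} (hα : Irrational α)
    (h : (α : UnitAddCircle) ∈ addWellApproximable UnitAddCircle (khinchinRadius φ K)) :
    ∃ᶠ M : ℕ in atTop, K < recipDistSum M α / ((M : ℝ) * Real.log M) / φ (Real.log M) := by
  rw [UnitAddCircle.mem_addWellApproximable_iff, ← Nat.frequently_atTop_iff_infinite] at h
  refine (h.and_eventually (eventually_ge_atTop 2)).mono ?_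
  rintro q ⟨⟨a, _, _, hlt⟩, hq⟩
  have hqR : (2 : ℝ) ≤ q := by exact_mod_cast hq
  have hq0 : (0 : ℝ) < q := by linarith
  have hG := logWeight_pos hφ_pos (show (1 : ℝ) < q by linarith)
  rw [← AddCircle.coe_sub, UnitAddCircle.norm_eq, khinchinRadius, max_eq_left hqR] at hlt
  have hd : distNearestInt (q * α) < 1 / (K * (q * logWeight φ q)) := by
    -- On the circle `a/q` is known only mod 1; adding `q` times the integer nearest to `α - a/q` to
    -- `a` gives an integer close to `qα`.
    calc distNearestInt (q * α)
        ≤ |(q : ℝ) * α - ((a : ℤ) + q * round (α - (a : ℝ) / q) : ℤ)| := distNearestInt_le _ _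
      _ = q * |α - (a : ℝ) / q - round (α - (a : ℝ) / q)| := by
          conv_rhs => rw [← abs_of_pos hq0, ← abs_mul, abs_of_pos hq0]
          congr 1
          push_cast
          rw [mul_sub, mul_sub, mul_div_cancel₀ _ hq0.ne']
          ring
      _ < q * (1 / (K * (q : ℝ) ^ 2 * logWeight φ q)) := by gcongr
      _ = 1 / (K * (q * logWeight φ q)) := by field_simp
  have hdpos := distNearestInt_pos hα (show 1 ≤ q by lia)
  have h1 : K * (q * logWeight φ q) < 1 / distNearestInt (q * α) := by
    rwa [lt_one_div (by positivity) hdpos]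
  have h2 : 1 / distNearestInt (q * α) ≤ recipDistSum q α :=
    Finset.single_le_sum (f := fun m : ℕ => 1 / distNearestInt (m * α))
      (fun m _ => one_div_nonneg.mpr (distNearestInt_nonneg _))
      (Finset.mem_Icc.mpr ⟨by lia, le_rfl⟩)
  rw [div_div, mul_assoc]
  change K < recipDistSum q α / (q * logWeight φ q)
  rw [lt_div_iff₀ (mul_pos hq0 hG)]
  exact h1.trans_le h2

theorem mainTheorem1 (φ : ℝ → ℝ)
    (hφ_pos : ∀ x : ℝ, 0 < x → 0 < φ x)
    (hφ_mono : MonotoneOn φ (Set.Ioi 0)) :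
    (Summable (fun k : ℕ => 1 / (((k : ℝ) + 1) * φ ((k : ℝ) + 1))) →
      ∀ᵐ α ∂(MeasureTheory.volume.restrict (Set.Ico (0 : ℝ) 1)),
        Filter.limsup
          (fun M : ℕ =>
            ((recipDistSum M α / ((M : ℝ) * Real.log M) / φ (Real.log M) : ℝ) : EReal))
          Filter.atTop = 0) ∧
    (¬ Summable (fun k : ℕ => 1 / (((k : ℝ) + 1) * φ ((k : ℝ) + 1))) →
      ∀ᵐ α ∂(MeasureTheory.volume.restrict (Set.Ico (0 : ℝ) 1)),
        Filter.limsup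
          (fun M : ℕ =>
            ((recipDistSum M α / ((M : ℝ) * Real.log M) / φ (Real.log M) : ℝ) : EReal))
          Filter.atTop = ⊤) := by
  rw [summable_one_div_natCast_mul]
  refine ⟨fun h => ?_, fun h => ?_⟩
  · filter_upwards [ae_tendsto_zero_of_summable hφ_pos hφ_mono h] with α hα
    exact ((continuous_coe_real_ereal.tendsto 0).comp hα).limsup_eq
  -- Khinchin's theorem is used for each `K = j + 1`; letting `j` grow pushes the limsup above every
  -- real.
  · have hall : ∀ᵐ α : ℝ, ∀ j : ℕ, (α : UnitAddCircle) ∈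
        addWellApproximable UnitAddCircle (khinchinRadius φ ((j : ℝ) + 1)) :=
      ae_all_iff.mpr fun j => ae_mem_addWellApproximable hφ_pos hφ_mono h (by positivity)
    filter_upwards [ae_restrict_of_ae hall, ae_irrational _] with α hα hirr
    rw [EReal.eq_top_iff_forall_lt]
    intro y
    obtain ⟨j, hj⟩ := exists_nat_gt y
    have hfreq := frequently_lt_of_mem_addWellApproximable hφ_pos (by positivity) hirr (hα j)
    calc (y : EReal) < (((j : ℝ) + 1 : ℝ) : EReal) := by
          rw [EReal.coe_lt_coe_iff]; linarith
      _ ≤ _ := le_limsup_of_frequently_le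
          (hfreq.mono fun M hM => EReal.coe_le_coe_iff.mpr hM.le)
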